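/- **Setting.** Let $\mathcal X$ be the space of finite measures on $[0,1]$ with the weak topology, and let $\bar{\mathcal X}=\mathcal X\cup\{\infty\}$ be its one-point compactification (the point $\infty$ stands for the infinite measures on $[0,1]$). $\mathcal P(S)$ is the space of probability measures on $S$ with the weak topology, and $D(S;\mathbb N)=S^{\mathbb N}$, $\mathbb N=\{0,1,2,\dots\}$, is the space of $S$-valued sequences with the product topology. Fix $a>0$, $b,\alpha\in\mathbb R$, $\Delta>0$, $M\in\mathbb R$, put $t_j=j\Delta$, and let $h:\mathbb R\to\mathbb R$ be bounded and continuous. Let $\phi_0$ be either a continuous function on $[0,1]$ or the Dirac delta at a point $x_0\in[0,1]$; write $\langle u,\phi_0\rangle=\int_0^1\phi_0(x)u(x)\,dx$, respectively $u(x_0)$. Let $\Theta=\{(\beta,\lambda):0<\beta<1,\ 0<\lambda\le M\}$. Let $P_t(y,x)=\sum_{j\ge0}e^{-\sigma_jt}\psi_j(y)\psi_j(x)$, $t>0$, be the Neumann Green function of $a\partial_x^2+b\partial_x$, where $c=-b/(2a)$, $\sigma_0=0$, $\psi_0=\sqrt{2c/(1-e^{-2c})}$ and, for $j\ge1$, $\sigma_j=a(c^2+(j\pi)^2)$,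 $\psi_j(x)=\sqrt2\,e^{cx}\sin(j\pi x+k_j)$, $k_j=\arctan(-j\pi/c)$ (if $c=0$: $\psi_0=1$, $k_j=-\pi/2$). For $\theta=(\beta,\lambda)\in\Theta$, $\nu\in\mathcal X$ and a counting path $N$ let, for $t>0$, $$U^{\theta,\nu,N}(t,x)=e^{-\alpha t}\int_0^1P_t(y,x)\,\nu(dy)+\int_0^te^{-\alpha(t-s)}P_{t-s}(\beta,x)\,dN_{\lambda s},$$ and let $U^{\theta,\nu,N}_t\in\mathcal X$ be the measure with this density; $U^{\theta,\nu,N}_0=\nu$. On a probability space $(\Omega,\mathbb P)$ let $N$ be a standard Poisson process, $U_0$ an $\mathcal X$-valued random variable independent of $N$, and $\varepsilon_1,\varepsilon_2,\dots$ independent standard normal variables, independent of $N$. Fix $\theta_0\in\Theta$. The signal is $U_{t_j}=U^{\theta_0,U_0,N}_{t_j}$, with density $U(t_j,\cdot)$ for $j\ge 1$, and the observations are $Y_j=h(\langle U(t_j,\cdot),\phi_0\rangle)+\varepsilon_j$, $j\ge1$; the entry $Y_0$ of the observation path is an arbitrary real random variable. For $n\ge1$ let $\hat\theta_n$ be any $\Theta$-valued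 measurable function of $(Y_1,\dots,Y_n)$. The approximating filters $\Pi^n_j$ are $\mathcal P(\mathcal X)$-valued random variables, arbitrary for $j<n$, and defined for $j\ge n$ by $$\langle\Pi^n_j,\phi\rangle=\frac{\int\tilde{\mathbb E}\big[\phi(U^{\hat\theta_n,\nu,\tilde N}_{t_1})\,R(U^{\hat\theta_n,\nu,\tilde N},Y_j)\big]\,\Pi^n_{j-1}(d\nu)}{\int\tilde{\mathbb E}\big[R(U^{\hat\theta_n,\nu,\tilde N},Y_j)\big]\,\Pi^n_{j-1}(d\nu)},\qquad \phi\in C_b(\mathcal X),$$ where $R(u,y)=\exp\{y\,h(\langle u(t_1,\cdot),\phi_0\rangle)-\tfrac12h^2(\langle u(t_1,\cdot),\phi_0\rangle)\}$, the process $\tilde N$ is an auxiliary standard Poisson process on another probability space, and $\tilde{\mathbb E}$ is the expectation over $\tilde N$ alone ($\hat\theta_n,Y_j,\Pi^n_{j-1}$ being held fixed). Each $\Pi^n_j$ is also regarded as an element of $\mathcal P(\bar{\mathcal X})$. Let $B_j=\sum_{i=1}^j\varepsilon_i$, $\Psi^n(j,\cdot)=(U_{t_{j+\cdot}},\Pi^n_{j+\cdot},Y_{j+\cdot},B_{j+\cdot}-B_j)$,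 and let $Q^{n,k}(C)=\frac1k\sum_{j=1}^kI_C(\Psi^n(j,\cdot))$ be the occupation measures, for $n,k\ge1$. A family of random elements of a topological space $S$ is tight if for every $\epsilon>0$ there is a compact $K\subseteq S$ such that each member lies in $K$ with probability at least $1-\epsilon$. **Theorem.** All the objects below are measurable, and 1. $\{U_{t_{j+\cdot}};\,j\ge0\}$ is tight in $D(\bar{\mathcal X};\mathbb N)$; 2. $\{\Pi^n_{j+\cdot};\,n>0,\,j\ge0\}$ is tight in $D(\mathcal P(\bar{\mathcal X});\mathbb N)$; 3. $\{Y_{j+\cdot};\,j\ge0\}$ is tight in $D(\mathbb R;\mathbb N)$; 4. the random measures $\{Q^{n,k};\,n>0,\,k>0\}$ are tight in $\mathcal P\big(D(\bar{\mathcal X};\mathbb N)\times D(\mathcal P(\bar{\mathcal X});\mathbb N)\times D(\mathbb R;\mathbb N)\times D(\mathbb R;\mathbb N)\big)$. -/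

import Mathlib

open MeasureTheory ProbabilityTheory Topology Filter Set
open scoped NNReal ENNReal BoundedContinuousFunction

namespace PollutionFilter

/-! ## Topology and measurability of spaces of measures

Spaces of finite (probability) measures carry the topology of weak convergence. For a compact
metrizable space `E`, finite measures on `E` form a locally compact second countable space, so its
one-point compactification is compact and metrizable. -/

section MeasureSpaces

variable {E : Type*} [TopologicalSpace E] [CompactSpace E] [TopologicalSpace.MetrizableSpace E]
  [MeasurableSpace E] [BorelSpace E]

lemma exists_isInducing_finiteMeasure :
    ∃ F : FiniteMeasure E → ℝ × (ℕ → ℝ), IsInducing F ∧ Measurable F := by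
  have hsep : TopologicalSpace.SeparableSpace C(E, ℝ) := by
    let _ := TopologicalSpace.metrizableSpaceMetric E
    infer_instance
  let g : ℕ → C(E, ℝ) := TopologicalSpace.denseSeq C(E, ℝ)
  have hg : DenseRange g := TopologicalSpace.denseRange_denseSeq _
  refine ⟨fun μ => (μ.mass, fun k => ∫ x, g k x ∂(μ : Measure E)), ?_, ?_⟩
  · rw [isInducing_iff_nhds]
    intro μ
    refine le_antisymm ?_ ?_
    · rw [← tendsto_iff_comap]
      refine Tendsto.prodMk_nhds ?_ ?_
      · exact (NNReal.continuous_coe.tendsto _).comp (FiniteMeasure.continuous_mass.tendsto μ)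
      · rw [tendsto_pi_nhds]
        intro k
        exact (FiniteMeasure.tendsto_iff_forall_integral_tendsto.1
          (tendsto_id : Tendsto id (𝓝 μ) (𝓝 μ))) (BoundedContinuousFunction.mkOfCompact (g k))
    · set L := comap (fun μ : FiniteMeasure E =>
        ((μ.mass : ℝ), fun k => ∫ x, g k x ∂(μ : Measure E)))
        (𝓝 ((μ.mass : ℝ), fun k => ∫ x, g k x ∂(μ : Measure E))) with hL
      have hT : Tendsto (fun μ : FiniteMeasure E =>
        ((μ.mass : ℝ), fun k => ∫ x, g k x ∂(μ : Measure E))) L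
        (𝓝 ((μ.mass : ℝ), fun k => ∫ x, g k x ∂(μ : Measure E))) := tendsto_comap
      have hm : Tendsto (fun ν : FiniteMeasure E => (ν.mass : ℝ)) L (𝓝 (μ.mass : ℝ)) :=
        (continuous_fst.tendsto _).comp hT
      have hk : ∀ k, Tendsto (fun ν : FiniteMeasure E => ∫ x, g k x ∂(ν : Measure E)) L
          (𝓝 (∫ x, g k x ∂(μ : Measure E))) := fun k =>
        (((continuous_apply k).comp continuous_snd).tendsto _).comp hT
      change Tendsto (fun ν : FiniteMeasure E => ν) L (𝓝 μ)
      rw [FiniteMeasure.tendsto_iff_forall_integral_tendsto]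
      intro f
      rw [Metric.tendsto_nhds]
      intro ε hε
      set C : ℝ := 2 * μ.mass + 1 + 1 with hC
      have hCpos : 0 < C := by positivity
      obtain ⟨k, hkf⟩ := hg.exists_dist_lt f.toContinuousMap (ε := ε / (2 * C)) (by positivity)
      have hbound : ∀ ν : FiniteMeasure E,
          |∫ x, f x ∂(ν : Measure E) - ∫ x, g k x ∂(ν : Measure E)| ≤ ε / (2 * C) * ν.mass := by
        intro ν
        have hi1 : Integrable (fun x => f x) (ν : Measure E) := f.integrable _
        have hi2 : Integrable (fun x => g k x) (ν : Measure E) :=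
          (BoundedContinuousFunction.mkOfCompact (g k)).integrable _
        rw [← integral_sub hi1 hi2]
        have h3 := norm_integral_le_of_norm_le_const (μ := (ν : Measure E))
          (f := fun x => f x - g k x) (C := ε / (2 * C)) (Eventually.of_forall fun x => by
            rw [← dist_eq_norm]
            exact ((ContinuousMap.dist_apply_le_dist (f := f.toContinuousMap) (g := g k) x).trans
              hkf.le))
        simpa [Measure.real, FiniteMeasure.mass] using! h3
      filter_upwards [(Metric.tendsto_nhds.1 hm) 1 one_pos,
        (Metric.tendsto_nhds.1 (hk k)) (ε / (2 * C)) (by positivity)] with ν h1 h2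
      rw [Real.dist_eq] at h1 h2 ⊢
      have b1 := abs_le.1 (hbound ν)
      have b2 := abs_le.1 (hbound μ)
      have h3 := abs_lt.1 h1
      have h4 := abs_lt.1 h2
      have hd : 0 < ε / (2 * C) := by positivity
      have hCe : ε / (2 * C) * C = ε / 2 := by field_simp
      have hnu : (ν.mass : ℝ) ≤ μ.mass + 1 := by linarith [h3.2]
      have hmul : ε / (2 * C) * ν.mass ≤ ε / (2 * C) * (μ.mass + 1) :=
        mul_le_mul_of_nonneg_left hnu hd.le
      rw [abs_lt]
      constructor <;> nlinarith [b1.1, b1.2, b2.1, b2.2, h4.1, h4.2]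
  · have hcoe : Measurable (fun μ : FiniteMeasure E => (μ : Measure E)) := measurable_subtype_coe
    refine Measurable.prodMk ?_ (measurable_pi_lambda _ fun k => ?_)
    · exact ((Measure.measurable_coe MeasurableSet.univ).comp hcoe).ennreal_toReal
    · have h0 : StronglyMeasurable (fun x => g k x) := (g k).continuous.stronglyMeasurable
      exact (h0.integral_kernel (κ := ⟨fun ν : FiniteMeasure E => (ν : Measure E), hcoe⟩)).measurable

instance : SecondCountableTopology (FiniteMeasure E) := by
  obtain ⟨F, hF, -⟩ := exists_isInducing_finiteMeasure (E := E)
  exact hF.secondCountableTopology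

instance : OpensMeasurableSpace (FiniteMeasure E) := by
  obtain ⟨F, hF, hm⟩ := exists_isInducing_finiteMeasure (E := E)
  refine ⟨MeasurableSpace.generateFrom_le ?_⟩
  rintro s hs
  obtain ⟨t, ht, rfl⟩ := hF.isOpen_iff.1 hs
  exact hm ht.measurableSet

instance : WeaklyLocallyCompactSpace (FiniteMeasure E) := by
  refine ⟨fun μ => ⟨{ν | ν.mass ≤ μ.mass + 1},
    isCompact_setOfPred_finiteMeasure_le_of_compactSpace E _, ?_⟩⟩
  refine mem_of_superset ((isOpen_lt FiniteMeasure.continuous_mass continuous_const).mem_nhds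
    (show μ.mass < μ.mass + 1 by simp)) fun ν (hν : ν.mass < μ.mass + 1) => ?_
  exact le_of_lt hν

instance : SecondCountableTopology (ProbabilityMeasure E) :=
  (ProbabilityMeasure.toFiniteMeasure_isEmbedding E).secondCountableTopology

instance : OpensMeasurableSpace (ProbabilityMeasure E) := by
  refine ⟨MeasurableSpace.generateFrom_le ?_⟩
  rintro s hs
  obtain ⟨t, ht, rfl⟩ :=
    (ProbabilityMeasure.toFiniteMeasure_isEmbedding E).isInducing.isOpen_iff.1 hs
  have : Measurable (ProbabilityMeasure.toFiniteMeasure : ProbabilityMeasure E → FiniteMeasure E) :=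
    measurable_subtype_coe.subtype_mk
  exact this ht.measurableSet

instance : SecondCountableTopology (OnePoint (FiniteMeasure E)) := by
  let B := TopologicalSpace.countableBasis (FiniteMeasure E)
  let S : Set (Set (OnePoint (FiniteMeasure E))) :=
    (fun b => ((↑) : FiniteMeasure E → OnePoint (FiniteMeasure E)) '' b) '' B ∪
      range (fun n : ℕ => (((↑) : FiniteMeasure E → OnePoint (FiniteMeasure E)) ''
        {ν | ν.mass ≤ n})ᶜ)
  have hS : TopologicalSpace.IsTopologicalBasis S := by
    refine TopologicalSpace.isTopologicalBasis_of_isOpen_of_nhds ?_ ?_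
    · rintro _ (⟨b, hb, rfl⟩ | ⟨n, rfl⟩)
      · exact OnePoint.isOpen_image_coe.2 (TopologicalSpace.isOpen_of_mem_countableBasis hb)
      · have hc := isCompact_setOfPred_finiteMeasure_le_of_compactSpace E (n : ℝ≥0)
        exact OnePoint.isOpen_compl_image_coe.2 ⟨hc.isClosed, hc⟩
    · intro a u ha hu
      induction a using OnePoint.rec with
      | infty =>
        have hK := ((OnePoint.isOpen_iff_of_mem ha).1 hu).2
        obtain ⟨M, hM⟩ := (hK.image FiniteMeasure.continuous_mass).bddAbove
        obtain ⟨n, hn⟩ := exists_nat_ge M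
        refine ⟨_, Or.inr ⟨n, rfl⟩, by simp, ?_⟩
        intro x hx
        by_contra hxu
        induction x using OnePoint.rec with
        | infty => exact hxu ha
        | coe x => exact hx ⟨x, (hM ⟨x, hxu, rfl⟩).trans hn, rfl⟩
      | coe a =>
        obtain ⟨v, hv, hav, hvu⟩ :=
          (TopologicalSpace.isBasis_countableBasis (FiniteMeasure E)).exists_subset_of_mem_open
            (show a ∈ ((↑) : FiniteMeasure E → OnePoint (FiniteMeasure E)) ⁻¹' u from ha)
            (hu.preimage OnePoint.continuous_coe)
        exact ⟨_, Or.inl ⟨v, hv, rfl⟩, ⟨a, hav, rfl⟩, image_subset_iff.2 hvu⟩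
  exact hS.secondCountableTopology
    (((TopologicalSpace.countable_countableBasis _).image _).union (countable_range _))

instance : TopologicalSpace.MetrizableSpace (OnePoint (FiniteMeasure E)) :=
  TopologicalSpace.metrizableSpace_of_t3_secondCountable _

/-- The one-point compactification carries its Borel sigma-algebra. -/
noncomputable instance : MeasurableSpace (OnePoint (FiniteMeasure E)) := borel _

instance : BorelSpace (OnePoint (FiniteMeasure E)) := ⟨rfl⟩

end MeasureSpaces


/-! ## State space, path space, tightness -/

/-- The space of finite measures on `[0,1]`, with the weak topology. -/
abbrev FMeas : Type := FiniteMeasure unitInterval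

/-- The compactified state space. The neighbourhoods of the point at infinity are the complements
of compact sets; this point stands for the infinite measures on `[0,1]`. -/
abbrev FMeasBar : Type := OnePoint FMeas

/-- The path space of `(U, Π, Y, B)`. As time is discrete, the path space of a space `S` is `ℕ → S`
with the product topology. -/
abbrev PathSpace : Type :=
  (ℕ → FMeasBar) × (ℕ → ProbabilityMeasure FMeasBar) × (ℕ → ℝ) × (ℕ → ℝ)

instance : OpensMeasurableSpace PathSpace := inferInstance

/-- A family `Z` of random elements of `S` is tight: its members are measurable and for every
`ε > 0` one compact subset of `S` contains every member with probability at least `1 - ε`. -/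
def IsTightFamily {Ω ι S : Type*} [MeasurableSpace Ω] [TopologicalSpace S] [MeasurableSpace S]
    (P : Measure Ω) (Z : ι → Ω → S) : Prop :=
  (∀ i, AEMeasurable (Z i) P) ∧ IsTightMeasureSet (range fun i => P.map (Z i))

/-- A standard Poisson process: counting paths that start at `0`, are nondecreasing and right
continuous, with independent increments; the increment over `(s, t]` is Poisson of mean `t - s`. -/
structure PoissonProcess {Ω : Type*} [MeasurableSpace Ω] (P : Measure Ω) where
  path : Ω → ℝ≥0 → ℕ
  measurable_path : ∀ t, Measurable fun ω => path ω t
  path_zero : ∀ ω, path ω 0 = 0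
  monotone_path : ∀ ω, Monotone (path ω)
  rightContinuous_path : ∀ ω t, ContinuousWithinAt (path ω) (Ici t) t
  indep_increments : HasIndepIncrements (fun t ω => (path ω t : ℝ)) P
  law_increments : ∀ s t, s ≤ t →
    P.map (fun ω => path ω t - path ω s) = poissonMeasure (t - s)

/-- The `k`-th jump time of a counting path `p` (meaningful if `p` reaches the value `k`). -/
noncomputable def jumpTime (p : ℝ≥0 → ℕ) (k : ℕ) : ℝ≥0 := sInf {s : ℝ≥0 | k ≤ p s}

/-- The observation weight on `[0,1]`: a continuous function or the Dirac delta at a point. -/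
inductive ObsWeight where
  | cont (φ : C(unitInterval, ℝ))
  | delta (x₀ : unitInterval)

/-- The parameters of the model: dispersion `a`, velocity `b`, dilution rate `α`, observation step
`Δ`, upper bound `M` for the intensity, bounded continuous `h`, observation weight `φ₀`. -/
structure Model where
  a : ℝ
  b : ℝ
  α : ℝ
  Δ : ℝ
  M : ℝ
  h : ℝ →ᵇ ℝ
  φ₀ : ObsWeight
  a_pos : 0 < a
  Δ_pos : 0 < Δ

namespace Model

variable (m : Model)

/-- The parameter set of all `(β, lam)` with `0 < β < 1` and `0 < lam ≤ M`. -/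
abbrev Param : Type := {θ : ℝ × ℝ // 0 < θ.1 ∧ θ.1 < 1 ∧ 0 < θ.2 ∧ θ.2 ≤ m.M}

noncomputable def c : ℝ := -m.b / (2 * m.a)

/-- `-σ j` is the `j`-th eigenvalue of `a ∂² + b ∂` with Neumann boundary conditions. -/
noncomputable def σ (j : ℕ) : ℝ := if j = 0 then 0 else m.a * (m.c ^ 2 + (j * Real.pi) ^ 2)

/-- The phase `arctan (-j π / c)`; for `c = 0` its limit as `c` decreases to `0`. -/
noncomputable def phase (j : ℕ) : ℝ :=
  if m.c = 0 then -(Real.pi / 2) else Real.arctan (-(j * Real.pi / m.c))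

/-- The eigenfunction for `-σ j`. For `c = 0` the constant `ψ 0` is the limit of the general one. -/
noncomputable def ψ (j : ℕ) (x : ℝ) : ℝ :=
  if j = 0 then
    if m.c = 0 then 1 else √(2 * m.c / (1 - Real.exp (-2 * m.c)))
  else √2 * Real.exp (m.c * x) * Real.sin (j * Real.pi * x + m.phase j)

/-- The Green function `P_t(y, x)`, for `t > 0`. -/
noncomputable def green (t y x : ℝ) : ℝ :=
  if 0 < t then ∑' j : ℕ, Real.exp (-m.σ j * t) * m.ψ j y * m.ψ j x else 0

/-- The concentration
`U(t,x) = e^{-α t} ∫ P_t(y,x) ν(dy) + ∫_0^t e^{-α (t-s)} P_{t-s}(β,x) dN_{lam s}`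
at time `t > 0` for the parameter `θ = (β, lam)`, initial measure `ν` and counting path `N = p`. The
jumps of `s ↦ p (lam s)` on `[0, t]` are at `τ_k / lam`, where `τ_k`, `1 ≤ k ≤ p (lam t)`, are the
jump times of `p`. (A jump exactly at time `t`, an event of probability zero, gives no term.) -/
noncomputable def density (θ : m.Param) (ν : FMeas) (p : ℝ≥0 → ℕ) (t x : ℝ) : ℝ :=
  Real.exp (-m.α * t) * (∫ y : unitInterval, m.green t y x ∂(ν : Measure unitInterval)) +
    ∑ k ∈ Finset.Icc 1 (p (θ.1.2 * t).toNNReal),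
      Real.exp (-m.α * (t - jumpTime p k / θ.1.2)) * m.green (t - jumpTime p k / θ.1.2) θ.1.1 x

/-- `⟨u, φ₀⟩ = ∫ φ₀(x) u(x) dx`, which is `u(x₀)` if `φ₀` is the Dirac delta at `x₀`. -/
noncomputable def pairing (u : ℝ → ℝ) : ℝ :=
  match m.φ₀ with
  | .cont φ => ∫ x : unitInterval, φ x * u x
  | .delta x₀ => u x₀

lemma abs_ψ_le (j : ℕ) (x : ℝ) : |m.ψ j x| ≤ |m.ψ 0 0| + √2 * Real.exp (|m.c| * |x|) := by
  by_cases hj : j = 0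
  · subst hj
    have : m.ψ 0 x = m.ψ 0 0 := by simp [ψ]
    rw [this]
    have : 0 ≤ √2 * Real.exp (|m.c| * |x|) := by positivity
    linarith
  · have h1 : |m.ψ j x| ≤ √2 * Real.exp (|m.c| * |x|) := by
      simp only [ψ, hj, if_false]
      rw [abs_mul, abs_mul, abs_of_nonneg (Real.sqrt_nonneg 2), Real.abs_exp]
      have h2 : Real.exp (m.c * x) ≤ Real.exp (|m.c| * |x|) := by
        rw [Real.exp_le_exp, ← abs_mul]; exact le_abs_self _
      calc √2 * Real.exp (m.c * x) * |Real.sin (j * Real.pi * x + m.phase j)|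
          ≤ √2 * Real.exp (m.c * x) * 1 :=
            mul_le_mul_of_nonneg_left (Real.abs_sin_le_one _) (by positivity)
        _ ≤ √2 * Real.exp (|m.c| * |x|) := by
            rw [mul_one]; exact mul_le_mul_of_nonneg_left h2 (by positivity)
    linarith [abs_nonneg (m.ψ 0 0)]

lemma summable_exp_σ {t : ℝ} (ht : 0 < t) : Summable fun j : ℕ => Real.exp (-m.σ j * t) := by
  have hr : 0 < m.a * Real.pi ^ 2 * t := by have := m.a_pos; positivity
  have hgeo : Summable fun j : ℕ => Real.exp (-(m.a * Real.pi ^ 2 * t)) ^ j :=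
    summable_geometric_of_lt_one (Real.exp_pos _).le (Real.exp_lt_one_iff.2 (by linarith))
  refine Summable.of_nonneg_of_le (fun j => (Real.exp_pos _).le) (fun j => ?_) hgeo
  rw [← Real.exp_nat_mul, Real.exp_le_exp]
  by_cases hj : j = 0
  · simp [σ, hj]
  · have h1 : (1 : ℝ) ≤ j := by exact_mod_cast Nat.one_le_iff_ne_zero.2 hj
    simp only [σ, hj, if_false]
    have h2 : (j : ℝ) ≤ (j : ℝ) ^ 2 := by nlinarith
    have h3 := mul_le_mul_of_nonneg_left h2 hr.le
    have h4 : 0 ≤ m.a * m.c ^ 2 * t := by have := m.a_pos; positivity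
    nlinarith

lemma summable_green {t : ℝ} (ht : 0 < t) (y x : ℝ) :
    Summable fun j : ℕ => Real.exp (-m.σ j * t) * m.ψ j y * m.ψ j x := by
  refine Summable.of_norm_bounded (((m.summable_exp_σ ht).mul_right
    (|m.ψ 0 0| + √2 * Real.exp (|m.c| * |y|))).mul_right
    (|m.ψ 0 0| + √2 * Real.exp (|m.c| * |x|))) fun j => ?_
  rw [Real.norm_eq_abs, abs_mul, abs_mul, Real.abs_exp]
  gcongr
  · exact m.abs_ψ_le j y
  · exact m.abs_ψ_le j x

lemma exists_green_bound (t : ℝ) :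
    ∃ C, ∀ y ∈ Icc (0 : ℝ) 1, ∀ x ∈ Icc (0 : ℝ) 1, |m.green t y x| ≤ C := by
  by_cases ht : 0 < t
  · set K := |m.ψ 0 0| + √2 * Real.exp |m.c| with hK
    have hψ : ∀ j, ∀ x ∈ Icc (0 : ℝ) 1, |m.ψ j x| ≤ K := by
      intro j x hx
      refine (m.abs_ψ_le j x).trans ?_
      have : |m.c| * |x| ≤ |m.c| := by
        rw [abs_of_nonneg hx.1]; exact mul_le_of_le_one_right (abs_nonneg _) hx.2
      rw [hK]
      gcongr
    refine ⟨∑' j, Real.exp (-m.σ j * t) * K * K, fun y hy x hx => ?_⟩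
    rw [green, if_pos ht, ← Real.norm_eq_abs]
    refine tsum_of_norm_bounded
      (((m.summable_exp_σ ht).mul_right K).mul_right K).hasSum fun j => ?_
    rw [Real.norm_eq_abs, abs_mul, abs_mul, Real.abs_exp]
    have := hψ j y hy
    have := hψ j x hx
    gcongr
  · exact ⟨0, fun y _ x _ => by simp [green, ht]⟩

lemma exists_density_bound (θ : m.Param) (ν : FMeas) (p : ℝ≥0 → ℕ) (t : ℝ) :
    ∃ C, ∀ x ∈ Icc (0 : ℝ) 1, m.density θ ν p t x ≤ C := by
  choose C hC using m.exists_green_bound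
  refine ⟨Real.exp (-m.α * t) * (C t * (ν : Measure unitInterval).real univ) +
    ∑ k ∈ Finset.Icc 1 (p (θ.1.2 * t).toNNReal),
      Real.exp (-m.α * (t - jumpTime p k / θ.1.2)) * C (t - jumpTime p k / θ.1.2),
      fun x hx => ?_⟩
  unfold density
  gcongr with k hk
  · refine (le_abs_self _).trans ?_
    rw [← Real.norm_eq_abs]
    exact norm_integral_le_of_norm_le_const (Eventually.of_forall fun y => hC t y y.2 x hx)
  · exact (le_abs_self _).trans (hC _ _ ⟨θ.2.1.le, θ.2.2.1.le⟩ x hx)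

/-- The measure `U_t(dx) = U(t,x) dx` on `[0,1]` for `t > 0`; it is the initial measure at `t = 0`. -/
noncomputable def stateMeasure (θ : m.Param) (ν : FMeas) (p : ℝ≥0 → ℕ) (t : ℝ) :
    Measure unitInterval :=
  if 0 < t then volume.withDensity fun x : unitInterval =>
    ENNReal.ofReal (m.density θ ν p t x) else ν

instance (θ : m.Param) (ν : FMeas) (p : ℝ≥0 → ℕ) (t : ℝ) :
    IsFiniteMeasure (m.stateMeasure θ ν p t) := by
  unfold stateMeasure
  split_ifs with ht
  · obtain ⟨C, hC⟩ := m.exists_density_bound θ ν p t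
    refine isFiniteMeasure_withDensity (ne_of_lt ?_)
    calc ∫⁻ x : unitInterval, ENNReal.ofReal (m.density θ ν p t x)
        ≤ ∫⁻ _ : unitInterval, ENNReal.ofReal C :=
          lintegral_mono fun x => ENNReal.ofReal_le_ofReal (hC x x.2)
      _ < ⊤ := by simp
  · infer_instance

/-- `U_t` as an element of the space of finite measures. -/
noncomputable def state (θ : m.Param) (ν : FMeas) (p : ℝ≥0 → ℕ) (t : ℝ) : FMeas :=
  ⟨m.stateMeasure θ ν p t, inferInstance⟩

section Measurability

lemma measurable_ψ (j : ℕ) : Measurable (m.ψ j) := by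
  unfold ψ
  split_ifs <;> fun_prop

lemma measurable_green : Measurable fun q : ℝ × ℝ × ℝ => m.green q.1 q.2.1 q.2.2 := by
  refine measurable_of_tendsto_metrizable (f := fun (n : ℕ) (q : ℝ × ℝ × ℝ) =>
    if 0 < q.1 then ∑ j ∈ Finset.range n,
      Real.exp (-m.σ j * q.1) * m.ψ j q.2.1 * m.ψ j q.2.2 else 0) (fun n => ?_) ?_
  · have := m.measurable_ψ
    exact Measurable.ite (measurableSet_lt measurable_const measurable_fst) (by fun_prop)
      measurable_const
  · rw [tendsto_pi_nhds]
    intro q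
    by_cases hq : 0 < q.1
    · simp only [green, hq, if_true]
      exact (m.summable_green hq q.2.1 q.2.2).hasSum.tendsto_sum_nat
    · simp [green, hq]

variable {Ω : Type*} [MeasurableSpace Ω] {P : Measure Ω}

lemma measurable_jumpTime (N : PoissonProcess P) (k : ℕ) :
    Measurable fun ω => jumpTime (N.path ω) k := by
  refine measurable_of_Iio fun r => ?_
  have : (fun ω => jumpTime (N.path ω) k) ⁻¹' Iio r =
      (⋃ q : ℚ, {ω | Real.toNNReal q < r ∧ k ≤ N.path ω (Real.toNNReal q)}) ∪
        {ω | 0 < r ∧ ∀ n : ℕ, N.path ω n < k} := by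
    ext ω
    simp only [mem_preimage, mem_Iio, mem_union, mem_iUnion, mem_ofPred_eq, jumpTime]
    by_cases hne : {s : ℝ≥0 | k ≤ N.path ω s}.Nonempty
    · rw [csInf_lt_iff (OrderBot.bddBelow _) hne]
      constructor
      · rintro ⟨s, hs, hsr⟩
        obtain ⟨q, -, hq1, hq2⟩ := (NNReal.lt_iff_exists_rat_btwn s r).1 hsr
        exact Or.inl ⟨q, hq2, le_trans hs (N.monotone_path ω hq1.le)⟩
      · rintro (⟨q, hq1, hq2⟩ | ⟨-, h⟩)
        · exact ⟨_, hq2, hq1⟩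
        · obtain ⟨s, hs⟩ := hne
          obtain ⟨n, hn⟩ := exists_nat_ge s
          exact absurd (h n) (not_lt.2 (le_trans hs (N.monotone_path ω hn)))
    · rw [not_nonempty_iff_eq_empty] at hne
      have h0 : ∀ s : ℝ≥0, N.path ω s < k := fun s => not_le.1 fun hs => by
        have : s ∈ ({s : ℝ≥0 | k ≤ N.path ω s}) := hs
        rw [hne] at this; exact this
      rw [hne]
      simp [h0, NNReal.sInf_empty]
  rw [this]
  have hN := N.measurable_path
  have h1 : ∀ q : ℚ, MeasurableSet
      {ω | Real.toNNReal q < r ∧ k ≤ N.path ω (Real.toNNReal q)} := fun q =>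
    (MeasurableSet.const _).inter (measurableSet_le measurable_const (hN _))
  have h2 : MeasurableSet {ω | 0 < r ∧ ∀ n : ℕ, N.path ω n < k} := by
    have : {ω | ∀ n : ℕ, N.path ω n < k} = ⋂ n : ℕ, {ω | N.path ω n < k} := by ext; simp
    have h3 : MeasurableSet {ω | ∀ n : ℕ, N.path ω n < k} := by
      rw [this]
      exact MeasurableSet.iInter fun n => measurableSet_lt (hN _) measurable_const
    exact (MeasurableSet.const _).inter h3
  exact (MeasurableSet.iUnion h1).union h2

lemma measurable_integral_finiteMeasure {β : Type*} [MeasurableSpace β]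
    {f : unitInterval → β → ℝ} (hf : Measurable fun q : unitInterval × β => f q.1 q.2) :
    Measurable fun q : FMeas × β => ∫ y, f y q.2 ∂(q.1 : Measure unitInterval) := by
  have hcoe : Measurable (fun μ : FMeas => (μ : Measure unitInterval)) := measurable_subtype_coe
  have hmass : Measurable fun μ : FMeas => (μ : Measure unitInterval) univ :=
    (Measure.measurable_coe MeasurableSet.univ).comp hcoe
  let κ : Kernel (FMeas × β) unitInterval :=
    { toFun := fun q => (1 + (q.1 : Measure unitInterval) univ)⁻¹ • (q.1 : Measure unitInterval)
      measurable' := by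
        refine Measure.measurable_of_measurable_coe _ fun s hs => ?_
        simp only [Measure.smul_apply, smul_eq_mul]
        exact ((measurable_const.add (hmass.comp measurable_fst)).inv).mul
          (((Measure.measurable_coe hs).comp hcoe).comp measurable_fst) }
  have hκ : ∀ q, κ q = (1 + (q.1 : Measure unitInterval) univ)⁻¹ • (q.1 : Measure unitInterval) :=
    fun q => rfl
  have : IsFiniteKernel κ := ⟨1, ENNReal.one_lt_top, fun q => by
    rw [hκ, Measure.smul_apply, smul_eq_mul, mul_comm, ← div_eq_mul_inv]
    exact ENNReal.div_le_of_le_mul (by simp)⟩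
  have h1 : StronglyMeasurable fun q : FMeas × β => ∫ y, f y q.2 ∂(κ q) :=
    StronglyMeasurable.integral_kernel_prod_right' (κ := κ)
      (f := fun z : (FMeas × β) × unitInterval => f z.2 z.1.2)
      (hf.comp (measurable_snd.prodMk (measurable_snd.comp measurable_fst))).stronglyMeasurable
  have h2 : (fun q : FMeas × β => ∫ y, f y q.2 ∂(q.1 : Measure unitInterval)) = fun q =>
      (1 + (q.1 : Measure unitInterval) univ).toReal * ∫ y, f y q.2 ∂(κ q) := by
    ext q
    rw [hκ, integral_smul_measure, smul_eq_mul, ← mul_assoc, ← ENNReal.toReal_mul,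
      ENNReal.mul_inv_cancel (by simp) (by simp), ENNReal.toReal_one, one_mul]
  rw [h2]
  exact ((measurable_const.add (hmass.comp measurable_fst)).ennreal_toReal).mul h1.measurable

lemma measurable_randomSum {β : Type*} [MeasurableSpace β] {n : β → ℕ} {F : ℕ → β → ℝ}
    (hn : Measurable n) (hF : ∀ k, Measurable (F k)) :
    Measurable fun q => ∑ k ∈ Finset.Icc 1 (n q), F k q := by
  have h : Measurable fun z : ℕ × β => ∑ k ∈ Finset.Icc 1 z.1, F k z.2 :=
    measurable_from_prod_countable_right fun n =>
      Finset.measurable_sum (Finset.Icc 1 n) fun k _ => hF k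
  exact h.comp (hn.prodMk measurable_id)

lemma measurable_jumpTerm (N : PoissonProcess P) (θ : m.Param) (t : ℝ) (k : ℕ) :
    Measurable fun z : Ω × ℝ => Real.exp (-m.α * (t - jumpTime (N.path z.1) k / θ.1.2)) *
      m.green (t - jumpTime (N.path z.1) k / θ.1.2) θ.1.1 z.2 := by
  have hj : Measurable fun z : Ω × ℝ => t - (jumpTime (N.path z.1) k : ℝ) / θ.1.2 :=
    measurable_const.sub
      ((((measurable_jumpTime N k).comp measurable_fst).coe_nnreal_real).div_const _)
  have h2 : Measurable fun z : Ω × ℝ =>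
      (t - (jumpTime (N.path z.1) k : ℝ) / θ.1.2, θ.1.1, z.2) :=
    hj.prodMk (measurable_const.prodMk measurable_snd)
  exact ((hj.const_mul (-m.α)).exp).mul (m.measurable_green.comp h2)

lemma measurable_density (N : PoissonProcess P) (θ : m.Param) (t : ℝ) :
    Measurable fun q : FMeas × Ω × ℝ => m.density θ q.1 (N.path q.2.1) t q.2.2 := by
  have h1 : Measurable fun q : FMeas × Ω × ℝ =>
      ∫ y : unitInterval, m.green t y q.2.2 ∂(q.1 : Measure unitInterval) := by
    have h0 : Measurable fun z : unitInterval × (Ω × ℝ) => m.green t z.1 z.2.2 :=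
      m.measurable_green.comp
        (f := fun z : unitInterval × (Ω × ℝ) => (t, (z.1 : ℝ), z.2.2)) (by fun_prop)
    exact measurable_integral_finiteMeasure (f := fun y (z : Ω × ℝ) => m.green t y z.2) h0
  have h2 := m.measurable_jumpTerm N θ t
  have h3 : Measurable fun q : FMeas × Ω × ℝ =>
      ∑ k ∈ Finset.Icc 1 (N.path q.2.1 (θ.1.2 * t).toNNReal),
        Real.exp (-m.α * (t - jumpTime (N.path q.2.1) k / θ.1.2)) *
          m.green (t - jumpTime (N.path q.2.1) k / θ.1.2) θ.1.1 q.2.2 :=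
    measurable_randomSum ((N.measurable_path _).comp (measurable_fst.comp measurable_snd))
      fun k => (h2 k).comp measurable_snd
  exact (h1.const_mul (Real.exp (-m.α * t))).add h3

lemma measurable_state (N : PoissonProcess P) (θ : m.Param) (t : ℝ) :
    Measurable fun q : FMeas × Ω => m.state θ q.1 (N.path q.2) t := by
  refine Measurable.subtype_mk ?_
  by_cases ht : 0 < t
  · simp only [stateMeasure, ht, if_true]
    refine Measure.measurable_of_measurable_coe _ fun s hs => ?_
    simp only [withDensity_apply _ hs]
    have h1 : Measurable fun z : (FMeas × Ω) × unitInterval =>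
        ENNReal.ofReal (m.density θ z.1.1 (N.path z.1.2) t z.2) :=
      ((m.measurable_density N θ t).comp (f := fun z : (FMeas × Ω) × unitInterval =>
        (z.1.1, z.1.2, (z.2 : ℝ))) (by fun_prop)).ennreal_ofReal
    exact h1.lintegral_prod_right'
  · simp only [stateMeasure, ht, if_false]
    exact measurable_subtype_coe.comp measurable_fst

lemma measurable_pairing (N : PoissonProcess P) (θ : m.Param) (t : ℝ) :
    Measurable fun q : FMeas × Ω => m.pairing (m.density θ q.1 (N.path q.2) t) := by
  have hd := m.measurable_density N θ t
  unfold pairing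
  split
  · rename_i φ _
    have h1 : Measurable fun z : (FMeas × Ω) × unitInterval =>
        φ z.2 * m.density θ z.1.1 (N.path z.1.2) t z.2 :=
      (φ.continuous.measurable.comp measurable_snd).mul
        (hd.comp (f := fun z : (FMeas × Ω) × unitInterval => (z.1.1, z.1.2, (z.2 : ℝ))) (by fun_prop))
    exact h1.stronglyMeasurable.integral_prod_right'.measurable
  · rename_i x₀ _
    exact hd.comp (f := fun z : FMeas × Ω => (z.1, z.2, (x₀ : ℝ))) (by fun_prop)

end Measurability

/-- `R(u, y) = exp (logR u y)` is the likelihood `exp (y h(u) - h(u)²/2)`. -/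
noncomputable def logR (u y : ℝ) : ℝ := y * m.h u - m.h u ^ 2 / 2

variable {Ω₁ : Type*} [MeasurableSpace Ω₁] {P₁ : Measure Ω₁}

lemma integrable_exp_logR [IsProbabilityMeasure P₁] (N : PoissonProcess P₁) (θ : m.Param)
    (y : ℝ) (π : ProbabilityMeasure FMeas) :
    Integrable (fun q : FMeas × Ω₁ => Real.exp
      (m.logR (m.pairing (m.density θ q.1 (N.path q.2) m.Δ)) y)) ((π : Measure FMeas).prod P₁) := by
  have hh : Measurable m.h := m.h.continuous.measurable
  have hp := m.measurable_pairing N θ m.Δ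
  refine Integrable.of_bound (C := Real.exp (|y| * ‖m.h‖)) ?_ (Eventually.of_forall fun q => ?_)
  · unfold logR
    exact (((hh.comp hp).const_mul y).sub
      (((hh.comp hp).pow_const 2).div_const 2)).exp.aestronglyMeasurable
  · rw [Real.norm_eq_abs, Real.abs_exp, Real.exp_le_exp, logR]
    set u := m.pairing (m.density θ q.1 (N.path q.2) m.Δ)
    have h1 : y * m.h u ≤ |y| * ‖m.h‖ := by
      refine (le_abs_self _).trans ?_
      rw [abs_mul]
      exact mul_le_mul_of_nonneg_left (m.h.norm_coe_le_norm u) (abs_nonneg y)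
    nlinarith [sq_nonneg (m.h u)]

/-- One filter step with parameter `θ` and observation `y`: the law of `U_{t_1}` reweighted by
`R(⟨U_{t_1}, φ₀⟩, y)` and normalized, where `U_0` has the law `π` and is independent of the driving
Poisson process. See `integral_filterStep` for the formula in terms of test functions. -/
noncomputable def filterStep [IsProbabilityMeasure P₁] (N : PoissonProcess P₁) (θ : m.Param)
    (y : ℝ) (π : ProbabilityMeasure FMeas) : ProbabilityMeasure FMeas :=
  ⟨(((π : Measure FMeas).prod P₁).tilted fun q =>
      m.logR (m.pairing (m.density θ q.1 (N.path q.2) m.Δ)) y).map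
        fun q => m.state θ q.1 (N.path q.2) m.Δ, by
    have := isProbabilityMeasure_tilted (m.integrable_exp_logR N θ y π)
    exact Measure.isProbabilityMeasure_map (m.measurable_state N θ m.Δ).aemeasurable⟩

lemma integral_filterStep [IsProbabilityMeasure P₁] (N : PoissonProcess P₁) (θ : m.Param)
    (y : ℝ) (π : ProbabilityMeasure FMeas) (φ : FMeas →ᵇ ℝ) :
    ∫ ν, φ ν ∂(m.filterStep N θ y π : Measure FMeas) =
      (∫ q, φ (m.state θ q.1 (N.path q.2) m.Δ) *
        Real.exp (m.logR (m.pairing (m.density θ q.1 (N.path q.2) m.Δ)) y)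
          ∂((π : Measure FMeas).prod P₁)) /
      ∫ q, Real.exp (m.logR (m.pairing (m.density θ q.1 (N.path q.2) m.Δ)) y)
          ∂((π : Measure FMeas).prod P₁) := by
  simp only [filterStep, ProbabilityMeasure.coe_mk]
  rw [integral_map (m.measurable_state N θ m.Δ).aemeasurable
    φ.continuous.measurable.aestronglyMeasurable, integral_tilted, ← integral_div]
  refine integral_congr_ae (Eventually.of_forall fun q => ?_)
  simp only [smul_eq_mul]
  ring

/-! ## The processes -/

variable {Ω : Type*} [MeasurableSpace Ω] {P : Measure Ω}

/-- The signal `U_{t_j}`, `t_j = j Δ`, with true parameter `θ₀` and initial value `U₀`. -/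
noncomputable def signal (θ₀ : m.Param) (N : PoissonProcess P) (U₀ : Ω → FMeas) (j : ℕ) (ω : Ω) :
    FMeas :=
  m.state θ₀ (U₀ ω) (N.path ω) (j * m.Δ)

/-- The observations `Y_j = h(⟨U_{t_j}, φ₀⟩) + ε_j`, `j ≥ 1`, where `ε_j` is `ε (j - 1)`. There is no
observation at time `0`; the entry `Y₀` there is arbitrary. -/
noncomputable def obs (θ₀ : m.Param) (N : PoissonProcess P) (U₀ : Ω → FMeas) (ε : ℕ → Ω → ℝ)
    (Y₀ : Ω → ℝ) : ℕ → Ω → ℝ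
  | 0, ω => Y₀ ω
  | j + 1, ω =>
      m.h (m.pairing (m.density θ₀ (U₀ ω) (N.path ω) ((j + 1 : ℕ) * m.Δ))) + ε j ω

/-- The approximating filter `Π^n_j` for observations `Y`: for `j ≥ n` it is the filter step with
parameter `est n (Y_1, …, Y_n)` and observation `Y_j`, applied to `Π^n_{j-1}`. For
`j < n` the estimator is not yet available and `Π^n_j` is an arbitrary `init n j`. The process `Nt` is the auxiliary Poisson process of the filter. -/
noncomputable def approxFilter [IsProbabilityMeasure P₁] (Nt : PoissonProcess P₁)
    (est : (n : ℕ) → (Fin n → ℝ) → m.Param) (init : ℕ → ℕ → Ω → ProbabilityMeasure FMeas)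
    (Y : ℕ → Ω → ℝ) (n : ℕ) : ℕ → Ω → ProbabilityMeasure FMeas
  | 0, ω => init n 0 ω
  | j + 1, ω =>
      if n ≤ j + 1 then
        m.filterStep Nt (est n fun i => Y (i + 1) ω) (Y (j + 1) ω)
          (approxFilter Nt est init Y n j ω)
      else init n (j + 1) ω

end Model

/-- A probability measure on finite measures, regarded on the compactified space. -/
noncomputable def toBar (π : ProbabilityMeasure FMeas) : ProbabilityMeasure FMeasBar :=
  π.map (f := ((↑) : FMeas → FMeasBar)) OnePoint.continuous_coe.measurable.aemeasurable

variable {Ω : Type*}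

/-- `B_j = ε_1 + … + ε_j`, where `ε_i` is `ε (i - 1)`. -/
def partialSum (ε : ℕ → Ω → ℝ) (j : ℕ) (ω : Ω) : ℝ := ∑ i ∈ Finset.range j, ε i ω

/-- The shifted path `(U_{j+·}, Π_{j+·}, Y_{j+·}, B_{j+·} - B_j)`. -/
noncomputable def shiftedPath (U : ℕ → Ω → FMeas) (flt : ℕ → Ω → ProbabilityMeasure FMeas)
    (Y B : ℕ → Ω → ℝ) (j : ℕ) (ω : Ω) : PathSpace :=
  (fun l => (U (j + l) ω : FMeasBar), fun l => toBar (flt (j + l) ω), fun l => Y (j + l) ω,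
    fun l => B (j + l) ω - B j ω)

/-- The occupation measure `C ↦ (1/k) ∑_{j=1}^k 1_C(Ψ_j(ω))` of random elements `Ψ_j`. -/
noncomputable def occupation {S : Type*} [MeasurableSpace S] (Ψ : ℕ → Ω → S) (k : ℕ+) (ω : Ω) :
    ProbabilityMeasure S :=
  ⟨((k : ℕ) : ℝ≥0∞)⁻¹ • ∑ j ∈ Finset.Icc 1 (k : ℕ), Measure.dirac (Ψ j ω), ⟨by
    simp only [Measure.smul_apply, Measure.finsetSum_apply, measure_univ, smul_eq_mul,
      Finset.sum_const, Nat.card_Icc, add_tsub_cancel_right, nsmul_eq_mul, mul_one]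
    exact ENNReal.inv_mul_cancel (by exact_mod_cast k.ne_zero) (ENNReal.natCast_ne_top _)⟩⟩

end PollutionFilter

open PollutionFilter

namespace PollutionFilter

/-! ## Joint measurability in the parameter -/

/-! Compactness does most of the work. `FMeasBar` is compact metrizable, hence so is the space of
probability measures on it, and a countable product of compact spaces is compact. The signal and
filter paths therefore live in compact spaces, where tightness asks for nothing beyond
measurability; the estimator, the initial filters and the index `n` have no influence on the compact
set.

The real coordinates need bounds uniform in time. An observation is a term bounded by `‖m.h‖` plus
noise whose law does not depend on time (`exists_isCompact_obs`), and an increment of `partialSum ε`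
over `l` steps is a sum of `l` such noise terms (`exists_isCompact_partialSum_sub`). Summable error
budgets over the coordinates turn these bounds into one compact set of paths
(`exists_isCompact_pi`).

For the occupation measures, the expected mass of a set is an average of the probabilities that the
shifted paths lie in it (`lintegral_occupation_le`). Uniform tightness of the shifted paths,
Markov's inequality and Prokhorov's theorem then give a compact set of probability measures
(`isTightFamily_occupation`).

The remaining labour is measurability. The filter is run with a random estimate of `(β, lam)`, so
one filter step must be measurable jointly in parameter, observation and prior
(`measurable_filterStep`); since `lam` rescales time, this needs joint measurability of the Poisson
path in time and chance (`measurable_path_uncurry`). -/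

/-- Right continuity makes the infimum defining `jumpTime` attained. The existence clause is needed
because `sInf ∅ = 0` in `ℝ≥0`: a level that is never reached has jump time `0`. -/
lemma le_path_iff_jumpTime_le {p : ℝ≥0 → ℕ} (hp : Monotone p)
    (hc : ∀ t, ContinuousWithinAt p (Ici t) t) (k : ℕ) (t : ℝ≥0) :
    k ≤ p t ↔ (∃ n : ℕ, k ≤ p n) ∧ jumpTime p k ≤ t := by
  constructor
  · intro h
    obtain ⟨n, hn⟩ := exists_nat_ge t
    exact ⟨⟨n, h.trans (hp hn)⟩, csInf_le (OrderBot.bddBelow _) h⟩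
  · rintro ⟨⟨n, hn⟩, ht⟩
    refine le_trans ?_ (hp ht)
    -- In the discrete space `ℕ`, right continuity means being constant on a right neighbourhood;
    -- the infimum puts a time with value at least `k` into it.
    have hev : ∀ᶠ s in 𝓝[≥] (jumpTime p k), p s = p (jumpTime p k) := by
      have := (hc (jumpTime p k)).eventually
        (IsOpen.eventually_mem (isOpen_discrete {p (jumpTime p k)}) rfl)
      exact this
    have hne : {s : ℝ≥0 | k ≤ p s}.Nonempty := ⟨n, hn⟩
    by_contra hlt
    obtain ⟨u, hu, hu'⟩ := (mem_nhdsGE_iff_exists_Ico_subset' (lt_add_one _)).1 hev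
    obtain ⟨s, hs, hsu⟩ := exists_lt_of_csInf_lt hne (show sInf {s : ℝ≥0 | k ≤ p s} < u from hu)
    have h1 : p s = p (jumpTime p k) := hu' ⟨csInf_le (OrderBot.bddBelow _) hs, hsu⟩
    exact hlt (h1 ▸ hs)

/-- Superlevel sets in `(t, ω)` are cut out by comparing `t` with a random jump time, which is
measurable. This allows evaluation of the path at the parameter-dependent time `lam * t`. -/
lemma measurable_path_uncurry {Ω : Type*} [MeasurableSpace Ω] {P : Measure Ω}
    (N : PoissonProcess P) : Measurable fun z : ℝ≥0 × Ω => N.path z.2 z.1 := by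
  refine measurable_of_Ici fun k => ?_
  have : (fun z : ℝ≥0 × Ω => N.path z.2 z.1) ⁻¹' Ici k =
      (⋃ n : ℕ, {z : ℝ≥0 × Ω | k ≤ N.path z.2 n}) ∩ {z | jumpTime (N.path z.2) k ≤ z.1} := by
    ext z
    simp [le_path_iff_jumpTime_le (N.monotone_path z.2) (N.rightContinuous_path z.2) k z.1]
  rw [this]
  exact (MeasurableSet.iUnion fun n : ℕ => measurableSet_le measurable_const
    ((N.measurable_path n).comp measurable_snd)).inter
      (measurableSet_le ((Model.measurable_jumpTime N k).comp measurable_snd) measurable_fst)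

namespace Model

variable (m : Model) {Ω : Type*} [MeasurableSpace Ω] {P : Measure Ω}

lemma measurable_density_param (N : PoissonProcess P) (t : ℝ) :
    Measurable fun q : m.Param × FMeas × Ω × ℝ =>
      m.density q.1 q.2.1 (N.path q.2.2.1) t q.2.2.2 := by
  have h1 : Measurable fun q : m.Param × FMeas × Ω × ℝ =>
      ∫ y : unitInterval, m.green t y q.2.2.2 ∂(q.2.1 : Measure unitInterval) := by
    have h0 : Measurable fun z : unitInterval × (Ω × ℝ) => m.green t z.1 z.2.2 :=
      m.measurable_green.comp
        (f := fun z : unitInterval × (Ω × ℝ) => (t, (z.1 : ℝ), z.2.2)) (by fun_prop)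
    exact (measurable_integral_finiteMeasure
      (f := fun y (z : Ω × ℝ) => m.green t y z.2) h0).comp measurable_snd
  have hθ : Measurable fun q : m.Param × FMeas × Ω × ℝ => q.1.1 :=
    measurable_subtype_coe.comp measurable_fst
  have h2 : ∀ k, Measurable fun q : m.Param × FMeas × Ω × ℝ =>
      Real.exp (-m.α * (t - jumpTime (N.path q.2.2.1) k / q.1.1.2)) *
        m.green (t - jumpTime (N.path q.2.2.1) k / q.1.1.2) q.1.1.1 q.2.2.2 := by
    intro k
    have hj : Measurable fun q : m.Param × FMeas × Ω × ℝ =>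
        t - (jumpTime (N.path q.2.2.1) k : ℝ) / q.1.1.2 :=
      measurable_const.sub (((measurable_jumpTime N k).comp (measurable_fst.comp
        (measurable_snd.comp measurable_snd))).coe_nnreal_real.div hθ.snd)
    exact ((hj.const_mul (-m.α)).exp).mul (m.measurable_green.comp
      (hj.prodMk (hθ.fst.prodMk (measurable_snd.comp (measurable_snd.comp measurable_snd)))))
  have h3 : Measurable fun q : m.Param × FMeas × Ω × ℝ =>
      N.path q.2.2.1 (q.1.1.2 * t).toNNReal :=
    (measurable_path_uncurry N).comp ((hθ.snd.mul_const t).real_toNNReal.prodMk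
      (measurable_fst.comp (measurable_snd.comp measurable_snd)))
  exact (h1.const_mul (Real.exp (-m.α * t))).add (measurable_randomSum h3 h2)

lemma measurable_state_param (N : PoissonProcess P) (t : ℝ) :
    Measurable fun q : m.Param × FMeas × Ω => m.state q.1 q.2.1 (N.path q.2.2) t := by
  refine Measurable.subtype_mk ?_
  by_cases ht : 0 < t
  · simp only [stateMeasure, ht, if_true]
    refine Measure.measurable_of_measurable_coe _ fun s hs => ?_
    simp only [withDensity_apply _ hs]
    have h1 : Measurable fun z : (m.Param × FMeas × Ω) × unitInterval =>
        ENNReal.ofReal (m.density z.1.1 z.1.2.1 (N.path z.1.2.2) t z.2) :=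
      ((m.measurable_density_param N t).comp
        (f := fun z : (m.Param × FMeas × Ω) × unitInterval =>
          (z.1.1, z.1.2.1, z.1.2.2, (z.2 : ℝ))) (by fun_prop)).ennreal_ofReal
    exact h1.lintegral_prod_right'
  · simp only [stateMeasure, ht, if_false]
    exact measurable_subtype_coe.comp (measurable_fst.comp measurable_snd)

lemma measurable_pairing_param (N : PoissonProcess P) (t : ℝ) :
    Measurable fun q : m.Param × FMeas × Ω =>
      m.pairing (m.density q.1 q.2.1 (N.path q.2.2) t) := by
  have hd := m.measurable_density_param N t
  unfold pairing
  split
  · rename_i φ _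
    have h1 : Measurable fun z : (m.Param × FMeas × Ω) × unitInterval =>
        φ z.2 * m.density z.1.1 z.1.2.1 (N.path z.1.2.2) t z.2 :=
      (φ.continuous.measurable.comp measurable_snd).mul
        (hd.comp (f := fun z : (m.Param × FMeas × Ω) × unitInterval =>
          (z.1.1, z.1.2.1, z.1.2.2, (z.2 : ℝ))) (by fun_prop))
    exact h1.stronglyMeasurable.integral_prod_right'.measurable
  · rename_i x₀ _
    exact hd.comp (f := fun z : m.Param × FMeas × Ω => (z.1, z.2.1, z.2.2, (x₀ : ℝ)))
      (by fun_prop)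

/-! ## Measurability of the filters -/

/-- The mass that the new filter gives to a set is the integral of likelihood over normalizing
constant, against a kernel depending measurably on the prior. Measurability of kernel integrals in
their parameter, applied once to the constant and once to the ratio, gives the claim. -/
lemma measurable_filterStep [IsProbabilityMeasure P] (N : PoissonProcess P) :
    Measurable fun q : m.Param × ℝ × ProbabilityMeasure FMeas =>
      m.filterStep N q.1 q.2.1 q.2.2 := by
  have hlog : Measurable fun z : (m.Param × ℝ × ProbabilityMeasure FMeas) × FMeas × Ω =>
      m.logR (m.pairing (m.density z.1.1 z.2.1 (N.path z.2.2) m.Δ)) z.1.2.1 := by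
    have hp : Measurable fun z : (m.Param × ℝ × ProbabilityMeasure FMeas) × FMeas × Ω =>
        m.h (m.pairing (m.density z.1.1 z.2.1 (N.path z.2.2) m.Δ)) :=
      m.h.continuous.measurable.comp ((m.measurable_pairing_param N m.Δ).comp
        (f := fun z : (m.Param × ℝ × ProbabilityMeasure FMeas) × FMeas × Ω =>
          (z.1.1, z.2.1, z.2.2)) (by fun_prop))
    unfold logR
    fun_prop
  have hst : Measurable fun z : (m.Param × ℝ × ProbabilityMeasure FMeas) × FMeas × Ω =>
      m.state z.1.1 z.2.1 (N.path z.2.2) m.Δ :=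
    (m.measurable_state_param N m.Δ).comp
      (f := fun z : (m.Param × ℝ × ProbabilityMeasure FMeas) × FMeas × Ω =>
        (z.1.1, z.2.1, z.2.2)) (by fun_prop)
  -- The prior, itself one of the variables, is read as a kernel; its product with `P` is the law of
  -- the initial measure and the independent driving noise.
  let κ₀ : Kernel (m.Param × ℝ × ProbabilityMeasure FMeas) FMeas :=
    ⟨fun q => (q.2.2 : Measure FMeas), measurable_subtype_coe.comp
      (measurable_snd.comp measurable_snd)⟩
  have : IsMarkovKernel κ₀ := ⟨fun q => inferInstanceAs (IsProbabilityMeasure (q.2.2 : Measure FMeas))⟩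
  let κ : Kernel (m.Param × ℝ × ProbabilityMeasure FMeas) (FMeas × Ω) :=
    κ₀ ×ₖ Kernel.const _ P
  have hκ : ∀ q, κ q = (q.2.2 : Measure FMeas).prod P := fun q => by
    simp only [κ, Kernel.prod_apply, Kernel.const_apply]
    rfl
  have hI : Measurable fun q : m.Param × ℝ × ProbabilityMeasure FMeas =>
      ∫ z, Real.exp (m.logR (m.pairing (m.density q.1 z.1 (N.path z.2) m.Δ)) q.2.1)
        ∂((q.2.2 : Measure FMeas).prod P) := by
    simp only [← hκ]
    exact (StronglyMeasurable.integral_kernel_prod_right' (κ := κ)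
      hlog.exp.stronglyMeasurable).measurable
  refine Measurable.subtype_mk (Measure.measurable_of_measurable_coe _ fun s hs => ?_)
  -- The domain of integration depends on `q`, so it is moved into an indicator on the product
  -- space, making the integrand one jointly measurable function.
  have hval : ∀ q : m.Param × ℝ × ProbabilityMeasure FMeas,
      ((((q.2.2 : Measure FMeas).prod P).tilted fun z =>
        m.logR (m.pairing (m.density q.1 z.1 (N.path z.2) m.Δ)) q.2.1).map
          fun z => m.state q.1 z.1 (N.path z.2) m.Δ) s =
      ∫⁻ z, indicator {w : (m.Param × ℝ × ProbabilityMeasure FMeas) × FMeas × Ω |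
          m.state w.1.1 w.2.1 (N.path w.2.2) m.Δ ∈ s}
        (fun w => ENNReal.ofReal
          (Real.exp (m.logR (m.pairing (m.density w.1.1 w.2.1 (N.path w.2.2) m.Δ)) w.1.2.1) /
          ∫ z, Real.exp (m.logR (m.pairing (m.density w.1.1 z.1 (N.path z.2) m.Δ)) w.1.2.1)
        ∂((w.1.2.2 : Measure FMeas).prod P))) (q, z) ∂κ q := by
    intro q
    have hm := m.measurable_state N q.1 m.Δ
    rw [Measure.map_apply hm hs, tilted_apply' _ _ (hm hs), hκ, ← lintegral_indicator (hm hs)]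
    rfl
  simp only [hval]
  refine Measurable.lintegral_kernel_prod_right' (κ := κ) (Measurable.indicator ?_ (hst hs))
  exact (hlog.exp.div (hI.comp measurable_fst)).ennreal_ofReal

lemma measurable_signal (θ₀ : m.Param) (N : PoissonProcess P) {U₀ : Ω → FMeas}
    (hU₀ : Measurable U₀) (j : ℕ) : Measurable (m.signal θ₀ N U₀ j) := by
  have h := (m.measurable_state N θ₀ (j * m.Δ)).comp (hU₀.prodMk measurable_id)
  unfold signal
  exact h

lemma measurable_obs (θ₀ : m.Param) (N : PoissonProcess P) {U₀ : Ω → FMeas}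
    (hU₀ : Measurable U₀) {ε : ℕ → Ω → ℝ} (hε : ∀ i, Measurable (ε i)) {Y₀ : Ω → ℝ}
    (hY₀ : Measurable Y₀) (j : ℕ) : Measurable (m.obs θ₀ N U₀ ε Y₀ j) := by
  cases j with
  | zero => exact hY₀
  | succ j =>
    exact (m.h.continuous.measurable.comp ((m.measurable_pairing N θ₀ _).comp
      (hU₀.prodMk measurable_id))).add (hε j)

lemma measurable_approxFilter {Ω₁ : Type*} [MeasurableSpace Ω₁] {P₁ : Measure Ω₁}
    [IsProbabilityMeasure P₁] (Nt : PoissonProcess P₁)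
    {est : (n : ℕ) → (Fin n → ℝ) → m.Param} (hest : ∀ n, Measurable (est n))
    {init : ℕ → ℕ → Ω → ProbabilityMeasure FMeas} (hinit : ∀ n j, Measurable (init n j))
    {Y : ℕ → Ω → ℝ} (hY : ∀ j, Measurable (Y j)) (n j : ℕ) :
    Measurable (m.approxFilter Nt est init Y n j) := by
  induction j with
  | zero =>
    have h : m.approxFilter Nt est init Y n 0 = init n 0 := by funext ω; rw [approxFilter]
    rw [h]
    exact hinit n 0
  | succ j ih =>
    have hin : Measurable fun ω =>
        ((est n fun i => Y (i + 1) ω), Y (j + 1) ω, m.approxFilter Nt est init Y n j ω) :=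
      ((hest n).comp (measurable_pi_lambda _ fun i => hY _)).prodMk ((hY _).prodMk ih)
    have hstep := (m.measurable_filterStep Nt).comp hin
    by_cases hn : n ≤ j + 1
    · have h : m.approxFilter Nt est init Y n (j + 1) = fun ω =>
          m.filterStep Nt (est n fun i => Y (i + 1) ω) (Y (j + 1) ω)
            (m.approxFilter Nt est init Y n j ω) := by
        funext ω
        rw [approxFilter, if_pos hn]
      rw [h]
      exact hstep
    · have h : m.approxFilter Nt est init Y n (j + 1) = init n (j + 1) := by
        funext ω
        rw [approxFilter, if_neg hn]
      rw [h]
      exact hinit n (j + 1)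

end Model

/-! ### Measurability of shifted paths and occupation measures. -/

lemma measurable_toBar : Measurable toBar :=
  ((Measure.measurable_map _ OnePoint.continuous_coe.measurable).comp
    measurable_subtype_coe).subtype_mk

lemma measurable_occupation {Ω S : Type*} [MeasurableSpace Ω] [MeasurableSpace S]
    {Ψ : ℕ → Ω → S} (hΨ : ∀ j, Measurable (Ψ j)) (k : ℕ+) : Measurable (occupation Ψ k) := by
  refine Measurable.subtype_mk (Measure.measurable_of_measurable_coe _ fun s hs => ?_)
  simp only [Measure.smul_apply, Measure.finsetSum_apply, smul_eq_mul]
  exact (Finset.measurable_sum _ fun j _ => (Measure.measurable_coe hs).comp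
    (Measure.measurable_dirac.comp (hΨ j))).const_mul _

lemma measurable_shiftedPath {Ω : Type*} [MeasurableSpace Ω] {U : ℕ → Ω → FMeas}
    {flt : ℕ → Ω → ProbabilityMeasure FMeas} {Y B : ℕ → Ω → ℝ} (hU : ∀ j, Measurable (U j))
    (hflt : ∀ j, Measurable (flt j)) (hY : ∀ j, Measurable (Y j)) (hB : ∀ j, Measurable (B j))
    (j : ℕ) : Measurable (shiftedPath U flt Y B j) :=
  (measurable_pi_lambda _ fun l => OnePoint.continuous_coe.measurable.comp (hU (j + l))).prodMk
    ((measurable_pi_lambda _ fun l => measurable_toBar.comp (hflt (j + l))).prodMk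
      ((measurable_pi_lambda _ fun l => hY (j + l)).prodMk
        (measurable_pi_lambda _ fun l => (hB (j + l)).sub (hB j))))

/-! ## Tightness -/

lemma isTightFamily_of_compactSpace {Ω ι S : Type*} [MeasurableSpace Ω] [TopologicalSpace S]
    [MeasurableSpace S] [CompactSpace S] {P : Measure Ω} {Z : ι → Ω → S}
    (hZ : ∀ i, Measurable (Z i)) : IsTightFamily P Z :=
  ⟨fun i => (hZ i).aemeasurable, .of_compactSpace⟩

lemma isTightFamily_of_forall_exists_isCompact {Ω ι S : Type*} [MeasurableSpace Ω]
    [TopologicalSpace S] [MeasurableSpace S] [OpensMeasurableSpace S] [T2Space S] {P : Measure Ω}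
    {Z : ι → Ω → S} (hZ : ∀ i, Measurable (Z i))
    (h : ∀ δ : ℝ≥0∞, 0 < δ → ∃ K : Set S, IsCompact K ∧ ∀ i, P (Z i ⁻¹' Kᶜ) ≤ δ) :
    IsTightFamily P Z := by
  refine ⟨fun i => (hZ i).aemeasurable,
    isTightMeasureSet_iff_exists_isCompact_measure_compl_le.2 fun δ hδ => ?_⟩
  obtain ⟨K, hK, hKZ⟩ := h δ hδ
  refine ⟨K, hK, ?_⟩
  rintro _ ⟨i, rfl⟩
  dsimp only
  rw [Measure.map_apply (hZ i) hK.measurableSet.compl]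
  exact hKZ i

/-- By Tychonoff, a product of coordinate compacts is compact; giving coordinate `l` the budget `δ'
l` with sum below `δ` controls the union of the exceptional events. Uniformity is needed in `i`
only, not in `l`. -/
lemma exists_isCompact_pi {Ω ι S : Type*} [MeasurableSpace Ω] [TopologicalSpace S]
    {P : Measure Ω} {Z : ι → Ω → ℕ → S}
    (h : ∀ l, ∀ δ : ℝ≥0∞, 0 < δ → ∃ K : Set S, IsCompact K ∧ ∀ i, P {ω | Z i ω l ∉ K} ≤ δ)
    {δ : ℝ≥0∞} (hδ : 0 < δ) :
    ∃ K : Set (ℕ → S), IsCompact K ∧ ∀ i, P (Z i ⁻¹' Kᶜ) ≤ δ := by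
  obtain ⟨δ', hδ', hsum⟩ := ENNReal.exists_pos_sum_of_countable' hδ.ne' ℕ
  choose K hK hKZ using fun l => h l (δ' l) (hδ' l)
  refine ⟨univ.pi K, isCompact_univ_pi hK, fun i => ?_⟩
  have hsub : Z i ⁻¹' (univ.pi K)ᶜ ⊆ ⋃ l, {ω | Z i ω l ∉ K l} := by
    intro ω hω
    simpa [Set.mem_pi] using hω
  calc P (Z i ⁻¹' (univ.pi K)ᶜ) ≤ ∑' l, P {ω | Z i ω l ∉ K l} :=
        (measure_mono hsub).trans (measure_iUnion_le _)
    _ ≤ ∑' l, δ' l := ENNReal.tsum_le_tsum fun l => hKZ l i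
    _ ≤ δ := hsum.le

/-! ### Uniform tail bounds for observations and noise increments. -/

lemma exists_measure_abs_gt_le {Ω : Type*} [MeasurableSpace Ω] {P : Measure Ω}
    [IsFiniteMeasure P] {X : Ω → ℝ} (hX : Measurable X) {δ : ℝ≥0∞} (hδ : 0 < δ) :
    ∃ r : ℝ, 0 ≤ r ∧ P {ω | r < |X ω|} ≤ δ := by
  have hT : Tendsto (fun n : ℕ => P {ω | (n : ℝ) < |X ω|}) atTop
      (𝓝 (P (⋂ n : ℕ, {ω | (n : ℝ) < |X ω|}))) := by
    refine tendsto_measure_iInter_atTop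
      (fun n => (measurableSet_lt measurable_const hX.abs).nullMeasurableSet) ?_
      ⟨0, measure_ne_top _ _⟩
    intro a b hab ω (hω : (b : ℝ) < |X ω|)
    exact lt_of_le_of_lt (by exact_mod_cast hab) hω
  have hempty : (⋂ n : ℕ, {ω | (n : ℝ) < |X ω|}) = ∅ := by
    refine eq_empty_of_forall_notMem fun ω hω => ?_
    obtain ⟨n, hn⟩ := exists_nat_ge |X ω|
    exact absurd (mem_iInter.1 hω n) (not_lt.2 hn)
  rw [hempty, measure_empty] at hT
  obtain ⟨n, hn⟩ := (hT.eventually (gt_mem_nhds hδ)).exists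
  exact ⟨n, n.cast_nonneg, hn.le⟩

lemma exists_uniform_measure_abs_gt_le {Ω : Type*} [MeasurableSpace Ω] {P : Measure Ω}
    {ρ : Measure ℝ} [IsFiniteMeasure ρ] {ε : ℕ → Ω → ℝ} (hε : ∀ i, Measurable (ε i))
    (hlaw : ∀ i, P.map (ε i) = ρ) {δ : ℝ≥0∞} (hδ : 0 < δ) :
    ∃ r : ℝ, 0 ≤ r ∧ ∀ i, P {ω | r < |ε i ω|} ≤ δ := by
  obtain ⟨r, hr0, hr⟩ := exists_measure_abs_gt_le (P := ρ) (X := id) measurable_id hδ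
  refine ⟨r, hr0, fun i => ?_⟩
  rw [← hlaw i, Measure.map_apply (hε i)
    (measurableSet_lt measurable_const measurable_id.abs)] at hr
  exact hr

lemma exists_isCompact_obs (m : Model) {Ω : Type*} [MeasurableSpace Ω] {P : Measure Ω}
    [IsProbabilityMeasure P] (θ₀ : m.Param) (N : PoissonProcess P) (U₀ : Ω → FMeas)
    {ρ : Measure ℝ} [IsFiniteMeasure ρ] {ε : ℕ → Ω → ℝ} (hε : ∀ i, Measurable (ε i))
    (hlaw : ∀ i, P.map (ε i) = ρ) {Y₀ : Ω → ℝ} (hY₀ : Measurable Y₀) {δ : ℝ≥0∞} (hδ : 0 < δ) :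
    ∃ K : Set ℝ, IsCompact K ∧ ∀ j, P {ω | m.obs θ₀ N U₀ ε Y₀ j ω ∉ K} ≤ δ := by
  obtain ⟨r, -, hr⟩ := exists_measure_abs_gt_le (P := P) hY₀ hδ
  obtain ⟨s, -, hs⟩ := exists_uniform_measure_abs_gt_le hε hlaw hδ
  -- The radius `r` serves the arbitrary entry at time `0`; `‖m.h‖ + s` serves all later times,
  -- however large the concentration is.
  refine ⟨Icc (-max r (‖m.h‖ + s)) (max r (‖m.h‖ + s)), isCompact_Icc, fun j => ?_⟩
  simp only [mem_Icc, ← abs_le, not_le]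
  cases j with
  | zero =>
    refine (measure_mono fun ω hω => ?_).trans hr
    have h1 : max r (‖m.h‖ + s) < |Y₀ ω| := hω
    exact lt_of_le_of_lt (le_max_left _ _) h1
  | succ j =>
    refine (measure_mono fun ω hω => ?_).trans (hs j)
    have h1 : ‖m.h‖ + s < |m.obs θ₀ N U₀ ε Y₀ (j + 1) ω| := lt_of_le_of_lt (le_max_right _ _) hω
    have h2 := abs_add_le
      (m.h (m.pairing (m.density θ₀ (U₀ ω) (N.path ω) ((j + 1 : ℕ) * m.Δ)))) (ε j ω)
    have h3 := m.h.norm_coe_le_norm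
      (m.pairing (m.density θ₀ (U₀ ω) (N.path ω) ((j + 1 : ℕ) * m.Δ)))
    rw [Real.norm_eq_abs] at h3
    rw [Model.obs] at h1
    rw [mem_ofPred_eq]
    linarith

lemma exists_isCompact_partialSum_sub {Ω : Type*} [MeasurableSpace Ω] {P : Measure Ω}
    {ρ : Measure ℝ} [IsFiniteMeasure ρ] {ε : ℕ → Ω → ℝ} (hε : ∀ i, Measurable (ε i))
    (hlaw : ∀ i, P.map (ε i) = ρ) (l : ℕ) {δ : ℝ≥0∞} (hδ : 0 < δ) :
    ∃ K : Set ℝ, IsCompact K ∧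
      ∀ j, P {ω | partialSum ε (j + l) ω - partialSum ε j ω ∉ K} ≤ δ := by
  -- Only the indices `i < l` enter `R`; spreading the budget over all of `ℕ` avoids dividing `δ` by
  -- `l`, which may be `0`.
  obtain ⟨δ', hδ', hsum⟩ := ENNReal.exists_pos_sum_of_countable' hδ.ne' ℕ
  choose r _ hr using fun i => exists_uniform_measure_abs_gt_le hε hlaw (hδ' i)
  set R := ∑ i ∈ Finset.range l, r i with hR
  refine ⟨Icc (-R) R, isCompact_Icc, fun j => ?_⟩
  have hsub : {ω | partialSum ε (j + l) ω - partialSum ε j ω ∉ Icc (-R) R} ⊆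
      ⋃ i, {ω | r i < |ε (j + i) ω|} := by
    intro ω hω
    by_contra hcon
    simp only [mem_iUnion, mem_ofPred_eq, not_exists, not_lt] at hcon
    refine hω ?_
    rw [mem_Icc, ← abs_le, partialSum, partialSum, Finset.sum_range_add, add_sub_cancel_left]
    exact (Finset.abs_sum_le_sum_abs _ _).trans (Finset.sum_le_sum fun i _ => hcon i)
  calc P {ω | partialSum ε (j + l) ω - partialSum ε j ω ∉ Icc (-R) R}
      ≤ ∑' i, P {ω | r i < |ε (j + i) ω|} := (measure_mono hsub).trans (measure_iUnion_le _)
    _ ≤ ∑' i, δ' i := ENNReal.tsum_le_tsum fun i => hr i (j + i)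
    _ ≤ δ := hsum.le

/-! ## Borel structure of spaces of probability measures -/

/-- Closed sets form a generating π-system, and the mass of a closed set is a limit of integrals of
bounded continuous functions, which vary continuously in the weak topology. -/
lemma measurable_probabilityMeasure_of_continuous {X E : Type*} [TopologicalSpace X]
    [MeasurableSpace X] [OpensMeasurableSpace X] [TopologicalSpace E] [MeasurableSpace E]
    [BorelSpace E] [HasOuterApproxClosed E] {f : X → ProbabilityMeasure E} (hf : Continuous f) :
    Measurable f := by
  refine Measurable.subtype_mk (f := fun x => (f x : Measure E)) ?_
  refine Measurable.measure_of_isPiSystem_of_isProbabilityMeasure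
    (S := {F | IsClosed F}) ?_ isPiSystem_isClosed fun F hF => ?_
  · rw [BorelSpace.measurable_eq (α := E), borel_eq_generateFrom_isClosed]
  · have hF : IsClosed F := hF
    refine measurable_of_tendsto_metrizable
      (f := fun n x => ∫⁻ y, hF.apprSeq n y ∂(f x : Measure E)) (fun n => ?_)
      (tendsto_pi_nhds.2 fun x => HasOuterApproxClosed.tendsto_lintegral_apprSeq hF (f x : Measure E))
    refine Continuous.measurable (continuous_iff_continuousAt.2 fun x => ?_)
    exact (ProbabilityMeasure.tendsto_iff_forall_lintegral_tendsto.1 (hf.tendsto x)) (hF.apprSeq n)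

/-- The sigma-algebra generated by evaluations is the weak Borel one. It makes `PathSpace` a Borel
space, as `isTightFamily_occupation` demands. -/
instance {E : Type*} [TopologicalSpace E] [CompactSpace E] [TopologicalSpace.MetrizableSpace E]
    [MeasurableSpace E] [BorelSpace E] : BorelSpace (ProbabilityMeasure E) := by
  refine ⟨le_antisymm ?_ (OpensMeasurableSpace.borel_le)⟩
  -- The identity is continuous; with the Borel sigma-algebra on its source, its measurability is
  -- exactly the missing inclusion.
  have h := @measurable_probabilityMeasure_of_continuous (ProbabilityMeasure E) E _ (borel _)
    (@OpensMeasurableSpace.mk _ _ (borel _) le_rfl) _ _ _ _ id continuous_id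
  intro s hs
  exact h hs

/-! ## Occupation measures -/

lemma lintegral_occupation_le {Ω S : Type*} [MeasurableSpace Ω] [MeasurableSpace S]
    {P : Measure Ω} {Ψ : ℕ → Ω → S} (hΨ : ∀ j, Measurable (Ψ j)) (k : ℕ+) {A : Set S}
    (hA : MeasurableSet A) {δ : ℝ≥0∞} (h : ∀ j, P (Ψ j ⁻¹' A) ≤ δ) :
    ∫⁻ ω, (occupation Ψ k ω : Measure S) A ∂P ≤ δ := by
  have h1 : ∀ ω, (occupation Ψ k ω : Measure S) A =
      ((k : ℕ) : ℝ≥0∞)⁻¹ * ∑ j ∈ Finset.Icc 1 (k : ℕ), (Ψ j ⁻¹' A).indicator 1 ω := by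
    intro ω
    simp only [occupation, ProbabilityMeasure.coe_mk, Measure.smul_apply, Measure.finsetSum_apply,
      smul_eq_mul, Measure.dirac_apply' _ hA]
    rfl
  have hm : ∀ j, Measurable ((Ψ j ⁻¹' A).indicator (1 : Ω → ℝ≥0∞)) := fun j =>
    measurable_one.indicator (hΨ j hA)
  simp only [h1]
  rw [lintegral_const_mul _ (Finset.measurable_sum _ fun j _ => hm j),
    lintegral_finsetSum _ fun j _ => hm j]
  calc ((k : ℕ) : ℝ≥0∞)⁻¹ * ∑ j ∈ Finset.Icc 1 (k : ℕ), ∫⁻ ω, (Ψ j ⁻¹' A).indicator 1 ω ∂P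
      ≤ ((k : ℕ) : ℝ≥0∞)⁻¹ * ∑ j ∈ Finset.Icc 1 (k : ℕ), δ := by
        gcongr with j hj
        rw [lintegral_indicator_one (hΨ j hA)]
        exact h j
    _ = δ := by
        rw [Finset.sum_const, Nat.card_Icc, add_tsub_cancel_right, nsmul_eq_mul, ← mul_assoc,
          ENNReal.inv_mul_cancel (by exact_mod_cast k.ne_zero) (ENNReal.natCast_ne_top _), one_mul]

/-- Occupation measures of a uniformly tight array of random elements form a tight family of random
measures. -/
lemma isTightFamily_occupation {Ω ι S : Type*} [MeasurableSpace Ω] [TopologicalSpace S]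
    [MeasurableSpace S] [BorelSpace S] [T2Space S] {P : Measure Ω} {Ψ : ι → ℕ → Ω → S}
    (hΨ : ∀ n j, Measurable (Ψ n j))
    (h : ∀ δ : ℝ≥0∞, 0 < δ → ∃ K : Set S, IsCompact K ∧ ∀ n j, P (Ψ n j ⁻¹' Kᶜ) ≤ δ) :
    IsTightFamily P (fun (i : ι × ℕ+) ω => occupation (Ψ i.1) i.2 ω) := by
  refine ⟨fun i => (measurable_occupation (hΨ i.1) i.2).aemeasurable,
    isTightMeasureSet_iff_exists_isCompact_measure_compl_le.2 fun δ hδ => ?_⟩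
  obtain ⟨δ', hδ', hsum⟩ := ENNReal.exists_pos_sum_of_countable' hδ.ne' ℕ
  let η : ℕ → ℝ≥0∞ := fun l => ((l + 1 : ℕ) : ℝ≥0∞)⁻¹
  have hη0 : ∀ l, η l ≠ 0 := fun l => ENNReal.inv_ne_zero.2 (ENNReal.natCast_ne_top _)
  have hηtop : ∀ l, η l ≠ ∞ := fun l => ENNReal.inv_ne_top.2 (by exact_mod_cast l.succ_ne_zero)
  -- The product `η l * δ' l` is chosen for Markov's inequality: mean mass at most `η l * δ' l`
  -- outside `K l` makes mass at least `η l` there an event of probability at most `δ' l`.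
  choose K hK hKΨ using fun l => h (η l * δ' l)
    (ENNReal.mul_pos (hη0 l) (hδ' l).ne')
  let T : Set (ProbabilityMeasure S) := {μ | ∀ l, (μ : Measure S) (K l)ᶜ ≤ η l}
  have hTm : MeasurableSet T := by
    have : T = ⋂ l, {μ : ProbabilityMeasure S | (μ : Measure S) (K l)ᶜ ≤ η l} := by ext; simp [T]
    rw [this]
    exact MeasurableSet.iInter fun l => measurableSet_le
      ((Measure.measurable_coe (hK l).measurableSet.compl).comp measurable_subtype_coe)
      measurable_const
  -- As `η l` tends to `0`, the single sequence `K l` witnesses tightness of all of `T`, and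
  -- Prokhorov's theorem makes its closure compact.
  have hT : IsTightMeasureSet {((μ : ProbabilityMeasure S) : Measure S) | μ ∈ T} := by
    refine isTightMeasureSet_iff_exists_isCompact_measure_compl_le.2 fun r hr => ?_
    obtain ⟨l, hl⟩ := ENNReal.exists_inv_nat_lt hr.ne'
    refine ⟨K l, hK l, ?_⟩
    rintro _ ⟨μ, hμ, rfl⟩
    refine (hμ l).trans (le_trans ?_ hl.le)
    exact ENNReal.inv_le_inv.2 (by exact_mod_cast l.le_succ)
  refine ⟨closure T, isCompact_closure_of_isTightMeasureSet hT, ?_⟩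
  rintro _ ⟨⟨n, k⟩, rfl⟩
  dsimp only
  refine (measure_mono (compl_subset_compl.2 subset_closure)).trans ?_
  have hQ := measurable_occupation (hΨ n) k
  rw [Measure.map_apply hQ hTm.compl]
  have hsub : occupation (Ψ n) k ⁻¹' Tᶜ ⊆
      ⋃ l, {ω | η l ≤ (occupation (Ψ n) k ω : Measure S) (K l)ᶜ} := by
    intro ω hω
    simp only [T, mem_preimage, mem_compl_iff, mem_ofPred_eq, not_forall, not_le] at hω
    obtain ⟨l, hl⟩ := hω
    exact mem_iUnion.2 ⟨l, hl.le⟩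
  refine (measure_mono hsub).trans ((measure_iUnion_le _).trans
    ((ENNReal.tsum_le_tsum fun l => ?_).trans hsum.le))
  have hAm : MeasurableSet (K l)ᶜ := (hK l).measurableSet.compl
  have hmarkov := mul_meas_ge_le_lintegral (μ := P)
    (f := fun ω => (occupation (Ψ n) k ω : Measure S) (K l)ᶜ)
    ((Measure.measurable_coe hAm).comp (measurable_subtype_coe.comp hQ)) (η l)
  have hle := hmarkov.trans (lintegral_occupation_le (hΨ n) k hAm (hKΨ l n))
  exact (ENNReal.mul_le_mul_iff_right (hη0 l) (hηtop l)).1 hle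

/-- The signal and filter factors are compact and enter as `univ`, so only the two real factors
share the budget, and the compact set does not depend on `n`. -/
lemma exists_isCompact_shiftedPath {Ω ι : Type*} [MeasurableSpace Ω] {P : Measure Ω}
    {U : ℕ → Ω → FMeas} {flt : ι → ℕ → Ω → ProbabilityMeasure FMeas} {Y B : ℕ → Ω → ℝ}
    (hY : ∀ l, ∀ δ : ℝ≥0∞, 0 < δ → ∃ K : Set ℝ, IsCompact K ∧ ∀ j, P {ω | Y (j + l) ω ∉ K} ≤ δ)
    (hB : ∀ l, ∀ δ : ℝ≥0∞, 0 < δ →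
      ∃ K : Set ℝ, IsCompact K ∧ ∀ j, P {ω | B (j + l) ω - B j ω ∉ K} ≤ δ)
    {δ : ℝ≥0∞} (hδ : 0 < δ) :
    ∃ K : Set PathSpace, IsCompact K ∧
      ∀ n j, P (shiftedPath U (flt n) Y B j ⁻¹' Kᶜ) ≤ δ := by
  have hδ2 : 0 < δ / 2 := ENNReal.half_pos hδ.ne'
  obtain ⟨K, hK, hKY⟩ := exists_isCompact_pi (Z := fun j ω l => Y (j + l) ω) hY hδ2
  obtain ⟨L, hL, hLB⟩ := exists_isCompact_pi (Z := fun j ω l => B (j + l) ω - B j ω) hB hδ2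
  refine ⟨univ ×ˢ univ ×ˢ K ×ˢ L, isCompact_univ.prod (isCompact_univ.prod (hK.prod hL)),
    fun n j => ?_⟩
  have hsub : shiftedPath U (flt n) Y B j ⁻¹' (univ ×ˢ univ ×ˢ K ×ˢ L)ᶜ ⊆
      ((fun ω l => Y (j + l) ω) ⁻¹' Kᶜ) ∪ ((fun ω l => B (j + l) ω - B j ω) ⁻¹' Lᶜ) := by
    intro ω hω
    simp only [shiftedPath, mem_preimage, mem_compl_iff, mem_prod, mem_univ, true_and] at hω
    exact not_and_or.1 hω
  calc P (shiftedPath U (flt n) Y B j ⁻¹' (univ ×ˢ univ ×ˢ K ×ˢ L)ᶜ)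
      ≤ δ / 2 + δ / 2 := (measure_mono hsub).trans
        ((measure_union_le _ _).trans (add_le_add (hKY j) (hLB j)))
    _ = δ := ENNReal.add_halves δ

end PollutionFilter

theorem theorem3p4
    {Ω Ω₁ : Type*} [MeasurableSpace Ω] [MeasurableSpace Ω₁]
    (P : Measure Ω) [IsProbabilityMeasure P] (P₁ : Measure Ω₁) [IsProbabilityMeasure P₁]
    (m : Model) (θ₀ : m.Param)
    (N : PoissonProcess P) (Nt : PoissonProcess P₁)
    (U₀ : Ω → FMeas) (hU₀ : Measurable U₀) (hU₀N : IndepFun U₀ N.path P)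
    (ε : ℕ → Ω → ℝ) (hε_meas : ∀ i, Measurable (ε i)) (hε_indep : iIndepFun ε P)
    (hε_law : ∀ i, P.map (ε i) = gaussianReal 0 1)
    (hεN : IndepFun (fun ω i => ε i ω) N.path P)
    (Y₀ : Ω → ℝ) (hY₀ : Measurable Y₀)
    (est : (n : ℕ) → (Fin n → ℝ) → m.Param) (hest : ∀ n, Measurable (est n))
    (init : ℕ → ℕ → Ω → ProbabilityMeasure FMeas) (hinit : ∀ n j, Measurable (init n j))
    (U : ℕ → Ω → FMeas) (hU : U = m.signal θ₀ N U₀)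
    (Y : ℕ → Ω → ℝ) (hY : Y = m.obs θ₀ N U₀ ε Y₀)
    (flt : ℕ → ℕ → Ω → ProbabilityMeasure FMeas) (hflt : flt = m.approxFilter Nt est init Y) :
    IsTightFamily P (fun (j : ℕ) ω (l : ℕ) => (U (j + l) ω : FMeasBar)) ∧
    IsTightFamily P (fun (i : ℕ+ × ℕ) ω (l : ℕ) => toBar (flt i.1 (i.2 + l) ω)) ∧
    IsTightFamily P (fun (j : ℕ) ω (l : ℕ) => Y (j + l) ω) ∧
    IsTightFamily P (fun (i : ℕ+ × ℕ+) ω =>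
      occupation (shiftedPath U (flt i.1) Y (partialSum ε)) i.2 ω) := by
  have hεm : ∀ j, Measurable (partialSum ε j) := fun j =>
    Finset.measurable_sum _ fun i _ => hε_meas i
  have hUm : ∀ j, Measurable (U j) := fun j => hU ▸ m.measurable_signal θ₀ N hU₀ j
  have hYm : ∀ j, Measurable (Y j) := fun j => hY ▸ m.measurable_obs θ₀ N hU₀ hε_meas hY₀ j
  have hfm : ∀ n j, Measurable (flt n j) := fun n j =>
    hflt ▸ m.measurable_approxFilter Nt hest hinit hYm n j
  have hYK : ∀ l, ∀ δ : ℝ≥0∞, 0 < δ →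
      ∃ K : Set ℝ, IsCompact K ∧ ∀ j, P {ω | Y (j + l) ω ∉ K} ≤ δ := by
    intro l δ hδ
    obtain ⟨K, hK, hKY⟩ := exists_isCompact_obs m θ₀ N U₀ hε_meas hε_law hY₀ hδ
    -- The same interval serves every time, hence every shift.
    exact ⟨K, hK, fun j => hY ▸ hKY (j + l)⟩
  refine ⟨?_, ?_, ?_, ?_⟩
  · exact isTightFamily_of_compactSpace fun j =>
      measurable_pi_lambda _ fun l => OnePoint.continuous_coe.measurable.comp (hUm (j + l))
  · exact isTightFamily_of_compactSpace fun i =>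
      measurable_pi_lambda _ fun l => measurable_toBar.comp (hfm i.1 (i.2 + l))
  · exact isTightFamily_of_forall_exists_isCompact
      (fun j => measurable_pi_lambda _ fun l => hYm (j + l))
      fun δ hδ => exists_isCompact_pi hYK hδ
  · exact isTightFamily_occupation
      (Ψ := fun (n : ℕ+) j => shiftedPath U (flt n) Y (partialSum ε) j)
      (fun n j => measurable_shiftedPath hUm (hfm n) hYm hεm j)
      fun δ hδ => exists_isCompact_shiftedPath hYK
        (fun l δ hδ => exists_isCompact_partialSum_sub hε_meas hε_law l hδ) hδ
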